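/- Let $X$ be a real Banach space with topological dual $X^*$. Let $\mathrm{conv}(X)$ be the set of all lower semicontinuous convex functions $f : X \to \mathbb{R}\cup\{\pm\infty\}$ that are proper (nowhere equal to $-\infty$ and not identically $+\infty$), ordered pointwise. A mapping $T : \mathrm{conv}(X)\to\mathrm{conv}(X)$ is called fully order reversing if it is a bijection and, for all $f,g\in\mathrm{conv}(X)$, $f\ge g \iff Tf\le Tg$. Then a fully order reversing mapping $T : \mathrm{conv}(X)\to\mathrm{conv}(X)$ exists if and only if $X$ is reflexive (the canonical embedding $X\to X^{**}$ is onto) and there is a linear homeomorphism from $X$ onto $X^*$. -/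

import Mathlib

/-- `conv(X)`: all proper lower semicontinuous convex functions `f : X → ℝ ∪ {±∞}`. Convexity of an
extended real-valued function is convexity of its epigraph in `X × ℝ`; proper means nowhere `-∞`
and not identically `+∞`. As a subtype of `X → EReal` it carries the pointwise order. -/
def convCone (X : Type*) [NormedAddCommGroup X] [NormedSpace ℝ X] : Set (X → EReal) :=
  {f | Convex ℝ {p : X × ℝ | f p.1 ≤ (p.2 : EReal)} ∧ LowerSemicontinuous f ∧
    (∀ x, f x ≠ ⊥) ∧ ∃ x, f x ≠ ⊤}

/-- A self-map of a partially ordered set is fully order reversing if it is a bijection and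
`f ≥ g ↔ T f ≤ T g`. -/
def FullyOrderReversing {P : Type*} [PartialOrder P] (T : P → P) : Prop :=
  Function.Bijective T ∧ ∀ f g : P, f ≥ g ↔ T f ≤ T g

/-- A normed space is reflexive if the canonical embedding `x ↦ (φ ↦ φ x)` into its
(topological) bidual is onto. -/
def ReflexiveSpace (X : Type*) [NormedAddCommGroup X] [NormedSpace ℝ X] : Prop :=
  Function.Surjective (NormedSpace.inclusionInDoubleDual ℝ X)

/-!
A fully order reversing map on `conv(X)` must exchange two kinds of elements that the order
recognizes. The continuous affine functions `ψ + e` are exactly the elements whose minorants form a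
chain (`forall_le_comparable_iff`, a consequence of the Fenchel–Moreau theorem
`exists_affineFun_le_of_lt`), and the spikes, finite at a single point `x` with value `c`, are
exactly the elements whose majorants form a chain (`forall_ge_comparable_iff`). Hence `T` sends the
spike `(x, c)` to the affine function `F x + A x c`, and `ψ + d` to the spike `(G ψ, B ψ d)`.
Since `ψ + d` lies below the spike `(x, c)` iff `ψ x + d ≤ c`, order reversal gives the functional
equation `A x (ψ x + d) + F x (G ψ) = B ψ d`. Eliminating `A` leaves a monotone additive surjection
of the real line, which is linear, so that `(F x - F 0) (G ψ - G 0) = τ * ψ x` for some `τ ≠ 0`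
(`FullyOrderReversing.exists_pairing`). As `G` is onto, `x ↦ F x - F 0` is a linear bijection with
closed graph, hence a linear homeomorphism `X → X*`, and `Φ ∈ X**` is evaluation at
`τ⁻¹ (G ψ - G 0)` with `ψ x = Φ (F x - F 0)` (`reflexive_and_equiv_of_pairing`).

Conversely, given a linear homeomorphism `e : X → X*` of a reflexive space, the map sending `f` to
`f* ∘ e` works: conjugation reverses the order and is injective because `f** = f` on `X`
(`conj_conj_apply`), and by reflexivity the same identity on `X*` makes it onto
(`conj_surjective`).
-/

/-! ### Affine functions and spikes -/

section ConvCone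

variable {E : Type*} [NormedAddCommGroup E] [NormedSpace ℝ E]

/-- The continuous affine function `x ↦ ψ x + e`, as an element of `conv(E)`. -/
noncomputable def affineFun (ψ : StrongDual ℝ E) (e : ℝ) : convCone E :=
  ⟨fun x => ((ψ x + e : ℝ) : EReal), by
    refine ⟨?_, ?_, fun x => EReal.coe_ne_bot _, 0, EReal.coe_ne_top _⟩
    · intro p hp q hq a b ha hb hab
      simp only [Set.mem_ofPred_eq, EReal.coe_le_coe_iff] at hp hq ⊢
      simp only [Prod.fst_add, Prod.smul_fst, map_add, map_smul, smul_eq_mul, Prod.snd_add,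
        Prod.smul_snd]
      calc a * ψ p.1 + b * ψ q.1 + e = a * (ψ p.1 + e) + b * (ψ q.1 + e) := by
            linear_combination (-e) * hab
        _ ≤ _ := by gcongr
    · exact (continuous_coe_real_ereal.comp (ψ.continuous.add continuous_const)).lowerSemicontinuous⟩

open Classical in
/-- The indicator function of the point `x` shifted by `c`: it takes the value `c` at `x` and `+∞`
elsewhere. -/
noncomputable def spike (x : E) (c : ℝ) : convCone E :=
  ⟨fun y => if y = x then (c : EReal) else ⊤, by
    have key : ∀ p : E × ℝ, (if p.1 = x then (c : EReal) else ⊤) ≤ (p.2 : EReal) ↔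
        p.1 = x ∧ c ≤ p.2 := by
      intro p
      split_ifs with h <;> simp [h]
    refine ⟨?_, ?_, fun y => ?_, x, by simp⟩
    · intro p hp q hq a b ha hb hab
      rw [Set.mem_ofPred_eq, key] at hp hq ⊢
      simp only [Prod.fst_add, Prod.smul_fst, smul_eq_mul, Prod.snd_add, Prod.smul_snd, hp.1, hq.1]
      refine ⟨by rw [← add_smul, hab, one_smul], ?_⟩
      calc c = a * c + b * c := by rw [← add_mul, hab, one_mul]
        _ ≤ _ := add_le_add (mul_le_mul_of_nonneg_left hp.2 ha) (mul_le_mul_of_nonneg_left hq.2 hb)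
    · rw [lowerSemicontinuous_iff_isClosed_preimage]
      intro r
      by_cases hr : r = ⊤
      · simp [hr]
      · refine Set.Finite.isClosed ((Set.finite_singleton x).subset fun y hy => ?_)
        by_contra hyx
        simp only [Set.mem_singleton_iff] at hyx
        simp [hyx, hr] at hy
    · dsimp only
      split_ifs <;> simp⟩

@[simp] lemma affineFun_apply (ψ : StrongDual ℝ E) (e : ℝ) (x : E) :
    (affineFun ψ e).1 x = ((ψ x + e : ℝ) : EReal) := rfl

@[simp] lemma spike_self (x : E) (c : ℝ) : (spike x c).1 x = c := by simp [spike]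

lemma spike_of_ne {x y : E} (h : y ≠ x) (c : ℝ) : (spike x c).1 y = ⊤ := by simp [spike, h]

lemma le_spike_iff {f : convCone E} {x : E} {c : ℝ} : f ≤ spike x c ↔ f.1 x ≤ c := by
  refine ⟨fun h => by simpa using h x, fun h y => ?_⟩
  by_cases hy : y = x
  · subst hy; simpa using h
  · simp [spike_of_ne hy]

lemma affineFun_le_spike_iff {ψ : StrongDual ℝ E} {x : E} {d c : ℝ} :
    affineFun ψ d ≤ spike x c ↔ ψ x + d ≤ c := by
  rw [le_spike_iff, affineFun_apply, EReal.coe_le_coe_iff]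

lemma spike_le_spike_iff {x x' : E} {c c' : ℝ} : spike x c ≤ spike x' c' ↔ x = x' ∧ c ≤ c' := by
  rw [le_spike_iff]
  by_cases h : x' = x
  · simp [h]
  · simp [spike_of_ne h, Ne.symm h]

lemma eq_of_affineFun_le_affineFun {ψ φ : StrongDual ℝ E} {d e : ℝ}
    (h : affineFun ψ d ≤ affineFun φ e) : ψ = φ ∧ d ≤ e := by
  have h' : ∀ x, ψ x + d ≤ φ x + e := fun x => EReal.coe_le_coe_iff.1 (h x)
  refine ⟨?_, by simpa using h' 0⟩
  ext x
  -- a linear functional bounded above vanishes: test on the line spanned by `x`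
  by_contra hne
  have hne' : ψ x - φ x ≠ 0 := sub_ne_zero.2 hne
  have := h' (((e - d + 1) / (ψ x - φ x)) • x)
  simp only [map_smul, smul_eq_mul] at this
  have h2 : (e - d + 1) / (ψ x - φ x) * (ψ x - φ x) = e - d + 1 := div_mul_cancel₀ _ hne'
  nlinarith

lemma affineFun_le_affineFun_iff {ψ φ : StrongDual ℝ E} {d e : ℝ} :
    affineFun ψ d ≤ affineFun φ e ↔ ψ = φ ∧ d ≤ e := by
  refine ⟨eq_of_affineFun_le_affineFun, ?_⟩
  rintro ⟨rfl, h⟩ x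
  exact EReal.coe_le_coe_iff.2 (by linarith)

lemma affineFun_le_iff {f : convCone E} {ψ : StrongDual ℝ E} {e : ℝ} :
    affineFun ψ e ≤ f ↔ ∀ x (t : ℝ), f.1 x ≤ t → ψ x + e ≤ t := by
  refine ⟨fun h x t ht => EReal.coe_le_coe_iff.1 ((h x).trans ht), fun h x => ?_⟩
  induction hx : f.1 x with
  | bot => exact absurd hx (f.2.2.2.1 x)
  | top => exact le_top
  | coe t => exact EReal.coe_le_coe_iff.2 (h x t hx.le)

lemma exists_eq_coe (f : convCone E) : ∃ (x : E) (t : ℝ), f.1 x = t := by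
  obtain ⟨x, hx⟩ := f.2.2.2.2
  exact ⟨x, (f.1 x).toReal, (EReal.coe_toReal hx (f.2.2.2.1 x)).symm⟩

/-! ### Affine minorants -/

/-- Separation of a point strictly below the graph of `f` from the epigraph of `f`; the coefficient
`s` of the vertical coordinate is nonnegative, but it may vanish. -/
lemma exists_separating_functional (f : convCone E) {x₀ : E} {r : ℝ} (hr : (r : EReal) < f.1 x₀) :
    ∃ (l : StrongDual ℝ E) (s u : ℝ), 0 ≤ s ∧ l x₀ + s * r < u ∧
      ∀ x (t : ℝ), f.1 x ≤ t → u < l x + s * t := by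
  have hcl : IsClosed {p : E × ℝ | f.1 p.1 ≤ (p.2 : EReal)} :=
    f.2.2.1.isClosed_epigraph.preimage
      (continuous_fst.prodMk (continuous_coe_real_ereal.comp continuous_snd))
  obtain ⟨L, u, h1, h2⟩ := geometric_hahn_banach_point_closed f.2.1 hcl
    (x := (x₀, r)) (by simpa using hr)
  have hL : ∀ x (t : ℝ), L (x, t) = L (x, 0) + L (0, 1) * t := by
    intro x t
    have : ((x, t) : E × ℝ) = (x, 0) + t • (0, 1) := by simp
    rw [this, map_add, map_smul, smul_eq_mul, mul_comm]
  have h2' : ∀ x (t : ℝ), f.1 x ≤ t → u < L (x, 0) + L (0, 1) * t := fun x t ht => by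
    rw [← hL]; exact h2 (x, t) ht
  refine ⟨L.comp (.inl ℝ E ℝ), L (0, 1), u, ?_, by rw [hL] at h1; simpa using h1,
    fun x t ht => by simpa using h2' x t ht⟩
  -- the epigraph is unbounded upwards, which excludes a negative vertical coefficient
  by_contra! hs
  obtain ⟨x, t, hx⟩ := exists_eq_coe f
  have h3 := h2' x (max t ((u - L (x, 0)) / L (0, 1))) (by rw [hx]; simp)
  have h4 : L (0, 1) * max t ((u - L (x, 0)) / L (0, 1)) ≤
      L (0, 1) * ((u - L (x, 0)) / L (0, 1)) :=
    mul_le_mul_of_nonpos_left (le_max_right _ _) hs.le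
  rw [mul_div_cancel₀ _ hs.ne] at h4
  linarith

/-- A nonvertical separating hyperplane is the graph of an affine minorant. -/
lemma exists_affineFun_le_of_pos {f : convCone E} {x₀ : E} {r s u : ℝ} {l : StrongDual ℝ E}
    (hs : 0 < s) (h1 : l x₀ + s * r < u) (h2 : ∀ x (t : ℝ), f.1 x ≤ t → u < l x + s * t) :
    ∃ (ψ : StrongDual ℝ E) (e : ℝ), affineFun ψ e ≤ f ∧ r < ψ x₀ + e := by
  refine ⟨-(s⁻¹ • l), s⁻¹ * u, affineFun_le_iff.2 fun x t ht => ?_, ?_⟩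
  · have := mul_le_mul_of_nonneg_left (h2 x t ht).le (inv_pos.2 hs).le
    rw [mul_add, inv_mul_cancel_left₀ hs.ne'] at this
    simp only [neg_apply, smul_apply, smul_eq_mul]
    linarith
  · have := mul_lt_mul_of_pos_left h1 (inv_pos.2 hs)
    rw [mul_add, inv_mul_cancel_left₀ hs.ne'] at this
    simp only [neg_apply, smul_apply, smul_eq_mul]
    linarith

/-- **Fenchel–Moreau**: every `f ∈ conv(E)` is the supremum of its continuous affine minorants. -/
lemma exists_affineFun_le_of_lt (f : convCone E) {x₀ : E} {r : ℝ} (hr : (r : EReal) < f.1 x₀) :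
    ∃ (ψ : StrongDual ℝ E) (e : ℝ), affineFun ψ e ≤ f ∧ r < ψ x₀ + e := by
  obtain ⟨l, s, u, hs, h1, h2⟩ := exists_separating_functional f hr
  rcases hs.lt_or_eq with hs | rfl
  · exact exists_affineFun_le_of_pos hs h1 h2
  -- A vertical hyperplane: tilt some affine minorant, obtained at a point of the effective domain
  -- (where the separating hyperplane is never vertical), by a large multiple of `u - l`.
  obtain ⟨y, t, hy⟩ := exists_eq_coe f
  obtain ⟨ψ, e, hψ⟩ : ∃ (ψ : StrongDual ℝ E) (e : ℝ), affineFun ψ e ≤ f := by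
    have hlt : ((t - 1 : ℝ) : EReal) < f.1 y := by rw [hy]; exact_mod_cast sub_one_lt t
    obtain ⟨l', s', u', hs', h1', h2'⟩ := exists_separating_functional f hlt
    have hpos : 0 < s' := by
      rcases hs'.lt_or_eq with h | rfl
      · exact h
      · have := h2' y t hy.le
        linarith
    obtain ⟨ψ, e, h, -⟩ := exists_affineFun_le_of_pos hpos h1' h2'
    exact ⟨ψ, e, h⟩
  rw [affineFun_le_iff] at hψ
  have hu : 0 < u - l x₀ := by linarith
  set N : ℝ := max 0 ((r - ψ x₀ - e + 1) / (u - l x₀)) with hN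
  have hN0 : 0 ≤ N := le_max_left _ _
  have hN1 : r - ψ x₀ - e + 1 ≤ N * (u - l x₀) := (div_le_iff₀ hu).1 (le_max_right _ _)
  refine ⟨ψ - N • l, e + N * u, affineFun_le_iff.2 fun x a ha => ?_, ?_⟩
  · have h3 := hψ x a ha
    have h4 := mul_le_mul_of_nonneg_left (h2 x a ha).le hN0
    simp only [sub_apply, smul_apply, smul_eq_mul]
    linarith
  · simp only [sub_apply, smul_apply, smul_eq_mul]
    linarith

lemma exists_affineFun_le (f : convCone E) :
    ∃ (ψ : StrongDual ℝ E) (e : ℝ), affineFun ψ e ≤ f := by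
  obtain ⟨y, t, hy⟩ := exists_eq_coe f
  obtain ⟨ψ, e, h, -⟩ := exists_affineFun_le_of_lt f (x₀ := y) (r := t - 1)
    (by rw [hy]; exact_mod_cast sub_one_lt t)
  exact ⟨ψ, e, h⟩

/-! ### Order characterizations of affine functions and spikes -/

/-- If all affine minorants of `f` have the same slope, then `f` is affine. -/
lemma eq_affineFun_of_forall_slope_eq {f : convCone E} {ψ : StrongDual ℝ E}
    (h : ∀ φ e, affineFun φ e ≤ f → φ = ψ) : ∃ e, f = affineFun ψ e := by
  obtain ⟨y, t, hy⟩ := exists_eq_coe f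
  have hle : ∀ x, f.1 x ≤ ((t - ψ y + ψ x : ℝ) : EReal) := by
    intro x
    by_contra! hlt
    obtain ⟨φ, e, hφ, h1⟩ := exists_affineFun_le_of_lt f hlt
    obtain rfl := h φ e hφ
    have := affineFun_le_iff.1 hφ y t hy.le
    linarith
  refine ⟨t - ψ y, le_antisymm (fun x => ?_) (affineFun_le_iff.2 fun x a ha => ?_)⟩
  · rw [affineFun_apply, add_comm]
    exact hle x
  · by_contra! hlt
    obtain ⟨φ, e, hφ, h1⟩ := exists_affineFun_le_of_lt f (x₀ := y) (r := a + ψ y - ψ x)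
      (by rw [hy, EReal.coe_lt_coe_iff]; linarith)
    obtain rfl := h φ e hφ
    have := affineFun_le_iff.1 hφ x a ha
    linarith

/-- The affine functions are the elements of `conv(E)` whose minorants form a chain. -/
lemma forall_le_comparable_iff (f : convCone E) :
    (∀ g h, g ≤ f → h ≤ f → g ≤ h ∨ h ≤ g) ↔ ∃ ψ e, f = affineFun ψ e := by
  constructor
  · intro H
    obtain ⟨ψ, e, hψ⟩ := exists_affineFun_le f
    refine ⟨ψ, eq_affineFun_of_forall_slope_eq fun φ d hφ => ?_⟩
    rcases H _ _ hφ hψ with h | h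
    · exact (eq_of_affineFun_le_affineFun h).1
    · exact (eq_of_affineFun_le_affineFun h).1.symm
  · rintro ⟨ψ, e, rfl⟩ g h hg hh
    have key : ∀ k : convCone E, k ≤ affineFun ψ e → ∃ a, k = affineFun ψ a := fun k hk =>
      eq_affineFun_of_forall_slope_eq fun φ d hφ => (eq_of_affineFun_le_affineFun (hφ.trans hk)).1
    obtain ⟨a, rfl⟩ := key g hg
    obtain ⟨b, rfl⟩ := key h hh
    simpa [affineFun_le_affineFun_iff] using le_total a b

/-- The spikes are the elements of `conv(E)` whose majorants form a chain. -/
lemma forall_ge_comparable_iff (f : convCone E) :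
    (∀ g h, f ≤ g → f ≤ h → g ≤ h ∨ h ≤ g) ↔ ∃ x c, f = spike x c := by
  constructor
  · intro H
    obtain ⟨x, c, hx⟩ := exists_eq_coe f
    refine ⟨x, c, le_antisymm (le_spike_iff.2 hx.le) fun y => ?_⟩
    by_cases hyx : y = x
    · subst hyx; simp [hx]
    induction hy : f.1 y with
    | bot => exact absurd hy (f.2.2.2.1 y)
    | top => exact le_top
    | coe a =>
      rcases H _ _ (le_spike_iff.2 hx.le) (le_spike_iff.2 hy.le) with h | h
      · exact absurd (spike_le_spike_iff.1 h).1.symm hyx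
      · exact absurd (spike_le_spike_iff.1 h).1 hyx
  · rintro ⟨x, c, rfl⟩ g h hg hh
    have key : ∀ k : convCone E, spike x c ≤ k → ∀ y, y ≠ x → k.1 y = ⊤ := fun k hk y hy => by
      have := hk y
      rwa [spike_of_ne hy, top_le_iff] at this
    refine (le_total (g.1 x) (h.1 x)).imp (fun hle y => ?_) fun hle y => ?_
    · by_cases hy : y = x
      · subst hy; exact hle
      · rw [key h hh y hy]; exact le_top
    · by_cases hy : y = x
      · subst hy; exact hle
      · rw [key g hg y hy]; exact le_top

/-! ### The action of an order reversing bijection on spikes and affine functions -/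

lemma FullyOrderReversing.exists_affineFun {T : convCone E → convCone E}
    (hT : FullyOrderReversing T) (x : E) (c : ℝ) : ∃ ψ e, T (spike x c) = affineFun ψ e := by
  rw [← forall_le_comparable_iff]
  intro g h hg hh
  obtain ⟨g, rfl⟩ := hT.1.2 g
  obtain ⟨h, rfl⟩ := hT.1.2 h
  rw [← hT.2, ← hT.2]
  exact (forall_ge_comparable_iff _).2 ⟨x, c, rfl⟩ h g ((hT.2 _ _).2 hh) ((hT.2 _ _).2 hg)

lemma FullyOrderReversing.exists_spike {T : convCone E → convCone E}
    (hT : FullyOrderReversing T) (ψ : StrongDual ℝ E) (e : ℝ) :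
    ∃ x c, T (affineFun ψ e) = spike x c := by
  rw [← forall_ge_comparable_iff]
  intro g h hg hh
  obtain ⟨g, rfl⟩ := hT.1.2 g
  obtain ⟨h, rfl⟩ := hT.1.2 h
  rw [← hT.2, ← hT.2]
  exact (forall_le_comparable_iff _).2 ⟨ψ, e, rfl⟩ h g ((hT.2 _ _).2 hh) ((hT.2 _ _).2 hg)

lemma FullyOrderReversing.exists_spike_preimage {T : convCone E → convCone E}
    (hT : FullyOrderReversing T) (ψ : StrongDual ℝ E) (e : ℝ) :
    ∃ x c, T (spike x c) = affineFun ψ e := by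
  obtain ⟨f, hf⟩ := hT.1.2 (affineFun ψ e)
  obtain ⟨x, c, rfl⟩ := (forall_ge_comparable_iff f).1 fun g h hg hh => by
    rw [ge_iff_le.symm.trans (hT.2 h g), ge_iff_le.symm.trans (hT.2 g h)]
    exact ((forall_le_comparable_iff _).2 ⟨ψ, e, hf⟩ _ _ ((hT.2 _ _).1 hg) ((hT.2 _ _).1 hh)).symm
  exact ⟨x, c, hf⟩

lemma FullyOrderReversing.exists_affineFun_preimage {T : convCone E → convCone E}
    (hT : FullyOrderReversing T) (x : E) (c : ℝ) : ∃ ψ e, T (affineFun ψ e) = spike x c := by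
  obtain ⟨f, hf⟩ := hT.1.2 (spike x c)
  obtain ⟨ψ, e, rfl⟩ := (forall_le_comparable_iff f).1 fun g h hg hh => by
    rw [ge_iff_le.symm.trans (hT.2 h g), ge_iff_le.symm.trans (hT.2 g h)]
    exact ((forall_ge_comparable_iff _).2 ⟨x, c, hf⟩ _ _ ((hT.2 _ _).1 hg) ((hT.2 _ _).1 hh)).symm
  exact ⟨ψ, e, hf⟩

/-- An order reversing bijection swaps spikes and affine functions; its action on the base points
and slopes is independent of the additive constants, and is onto, and so is its action on the
constants. -/
lemma FullyOrderReversing.exists_parametrization {T : convCone E → convCone E}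
    (hT : FullyOrderReversing T) :
    ∃ (F : E → StrongDual ℝ E) (G : StrongDual ℝ E → E) (A : E → ℝ → ℝ)
      (B : StrongDual ℝ E → ℝ → ℝ),
      (∀ x c, T (spike x c) = affineFun (F x) (A x c)) ∧
      (∀ ψ d, T (affineFun ψ d) = spike (G ψ) (B ψ d)) ∧
      F.Surjective ∧ G.Surjective ∧ (∀ x, (A x).Surjective) ∧ ∀ ψ, (B ψ).Surjective := by
  choose F A hF using hT.exists_affineFun
  choose G B hG using hT.exists_spike
  -- two spikes are comparable iff they have the same base point, two affine functions iff they
  -- have the same slope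
  have hF1 : ∀ x y c d, F x c = F y d ↔ x = y := by
    intro x y c d
    constructor
    · intro h
      rcases le_total (A x c) (A y d) with hle | hle
      · have : T (spike x c) ≤ T (spike y d) := by
          rw [hF, hF, affineFun_le_affineFun_iff]; exact ⟨h, hle⟩
        exact (spike_le_spike_iff.1 ((hT.2 _ _).2 this)).1.symm
      · have : T (spike y d) ≤ T (spike x c) := by
          rw [hF, hF, affineFun_le_affineFun_iff]; exact ⟨h.symm, hle⟩
        exact (spike_le_spike_iff.1 ((hT.2 _ _).2 this)).1
    · rintro rfl
      rcases le_total c d with hle | hle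
      · have := (hT.2 (spike x d) (spike x c)).1 (spike_le_spike_iff.2 ⟨rfl, hle⟩)
        rw [hF, hF] at this
        exact (eq_of_affineFun_le_affineFun this).1.symm
      · have := (hT.2 (spike x c) (spike x d)).1 (spike_le_spike_iff.2 ⟨rfl, hle⟩)
        rw [hF, hF] at this
        exact (eq_of_affineFun_le_affineFun this).1
  have hG1 : ∀ ψ φ c d, G ψ c = G φ d ↔ ψ = φ := by
    intro ψ φ c d
    constructor
    · intro h
      rcases le_total (B ψ c) (B φ d) with hle | hle
      · have : T (affineFun ψ c) ≤ T (affineFun φ d) := by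
          rw [hG, hG, spike_le_spike_iff]; exact ⟨h, hle⟩
        exact (eq_of_affineFun_le_affineFun ((hT.2 _ _).2 this)).1.symm
      · have : T (affineFun φ d) ≤ T (affineFun ψ c) := by
          rw [hG, hG, spike_le_spike_iff]; exact ⟨h.symm, hle⟩
        exact (eq_of_affineFun_le_affineFun ((hT.2 _ _).2 this)).1
    · rintro rfl
      rcases le_total c d with hle | hle
      · have := (hT.2 (affineFun ψ d) (affineFun ψ c)).1
          (affineFun_le_affineFun_iff.2 ⟨rfl, hle⟩)
        rw [hG, hG] at this
        exact (spike_le_spike_iff.1 this).1.symm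
      · have := (hT.2 (affineFun ψ c) (affineFun ψ d)).1
          (affineFun_le_affineFun_iff.2 ⟨rfl, hle⟩)
        rw [hG, hG] at this
        exact (spike_le_spike_iff.1 this).1
  refine ⟨fun x => F x 0, fun ψ => G ψ 0, A, B, fun x c => ?_, fun ψ d => ?_, fun ψ => ?_,
    fun x => ?_, fun x v => ?_, fun ψ v => ?_⟩
  · rw [hF, (hF1 x x c 0).2 rfl]
  · rw [hG, (hG1 ψ ψ d 0).2 rfl]
  · obtain ⟨x, c, h⟩ := hT.exists_spike_preimage ψ 0
    rw [hF] at h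
    exact ⟨x, ((hF1 x x 0 c).2 rfl).trans (eq_of_affineFun_le_affineFun h.le).1⟩
  · obtain ⟨ψ, e, h⟩ := hT.exists_affineFun_preimage x 0
    rw [hG] at h
    exact ⟨ψ, ((hG1 ψ ψ 0 e).2 rfl).trans (spike_le_spike_iff.1 h.le).1⟩
  · obtain ⟨y, c, h⟩ := hT.exists_spike_preimage (F x 0) v
    rw [hF] at h
    obtain rfl := (hF1 y x c 0).1 (eq_of_affineFun_le_affineFun h.le).1
    exact ⟨c, le_antisymm (eq_of_affineFun_le_affineFun h.le).2
      (eq_of_affineFun_le_affineFun h.ge).2⟩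
  · obtain ⟨φ, e, h⟩ := hT.exists_affineFun_preimage (G ψ 0) v
    rw [hG] at h
    obtain rfl := (hG1 φ ψ e 0).1 (spike_le_spike_iff.1 h.le).1
    exact ⟨e, le_antisymm (spike_le_spike_iff.1 h.le).2 (spike_le_spike_iff.1 h.ge).2⟩

/-- Up to translations, the actions of `T` on base points and on slopes are adjoint to each other
up to a nonzero scalar. -/
lemma FullyOrderReversing.exists_pairing {T : convCone E → convCone E}
    (hT : FullyOrderReversing T) :
    ∃ (L : E → StrongDual ℝ E) (H : StrongDual ℝ E → E) (τ : ℝ), L.Surjective ∧ H.Surjective ∧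
      τ ≠ 0 ∧ ∀ x ψ, L x (H ψ) = τ * ψ x := by
  obtain ⟨F, G, A, B, hF, hG, hFs, hGs, hAs, hBs⟩ := hT.exists_parametrization
  have hAanti : ∀ x, Antitone (A x) := fun x c d hcd => by
    have := (hT.2 (spike x d) (spike x c)).1 (spike_le_spike_iff.2 ⟨rfl, hcd⟩)
    rw [hF, hF] at this
    exact (eq_of_affineFun_le_affineFun this).2
  have hBanti : ∀ ψ, Antitone (B ψ) := fun ψ c d hcd => by
    have := (hT.2 (affineFun ψ d) (affineFun ψ c)).1 (affineFun_le_affineFun_iff.2 ⟨rfl, hcd⟩)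
    rw [hG, hG] at this
    exact (spike_le_spike_iff.1 this).2
  -- `T` preserves the incidence of spikes and affine functions
  have hinc : ∀ x ψ c d, ψ x + d ≤ c ↔ F x (G ψ) + A x c ≤ B ψ d := fun x ψ c d => by
    rw [← affineFun_le_spike_iff, ← affineFun_le_spike_iff, ← hF, ← hG]
    exact hT.2 _ _
  have heq : ∀ x ψ d, A x (ψ x + d) = B ψ d - F x (G ψ) := by
    intro x ψ d
    apply le_antisymm
    · linarith [(hinc x ψ _ d).1 le_rfl]
    · obtain ⟨c, hc⟩ := hAs x (B ψ d - F x (G ψ))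
      rw [← hc]
      exact hAanti x ((hinc x ψ c d).2 (by linarith))
  -- eliminating `A` and `B` (through `ψ = 0` and `x = 0`) leaves one function of a real variable
  let γ : ℝ → ℝ := fun s => B 0 0 - B 0 s
  have hγ : ∀ x ψ d, γ (ψ x + d) - γ d = (F x - F 0) (G ψ - G 0) := by
    intro x ψ d
    have h1 := heq x ψ d
    have h2 := heq x 0 (ψ x + d)
    have h3 := heq 0 ψ d
    have h4 := heq 0 0 d
    simp only [zero_apply, map_zero, zero_add] at h2 h3 h4
    simp only [γ, sub_apply, map_sub]
    linarith
  have hγ0 : γ 0 = 0 := sub_self _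
  have hL : (fun x => F x - F 0).Surjective := fun φ => by
    obtain ⟨x, hx⟩ := hFs (φ + F 0)
    exact ⟨x, by simp [hx]⟩
  have hH : (fun ψ => G ψ - G 0).Surjective := fun y => by
    obtain ⟨ψ, hψ⟩ := hGs (y + G 0)
    exact ⟨ψ, by simp [hψ]⟩
  rcases subsingleton_or_nontrivial E with hE | hE
  · refine ⟨_, _, 1, hL, hH, one_ne_zero, fun x ψ => ?_⟩
    rw [Subsingleton.elim (G ψ - G 0) 0, Subsingleton.elim x 0]
    simp
  obtain ⟨x₀, hx₀⟩ := exists_ne (0 : E)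
  obtain ⟨ψ₀, hψ₀⟩ := SeparatingDual.exists_eq_one (R := ℝ) hx₀
  have hadd : ∀ s d, γ (s + d) = γ s + γ d := by
    intro s d
    have h1 := hγ (s • x₀) ψ₀ d
    have h2 := hγ (s • x₀) ψ₀ 0
    rw [map_smul, hψ₀, smul_eq_mul, mul_one] at h1 h2
    rw [add_zero, hγ0] at h2
    linarith
  have hmono : Monotone γ := fun s d hsd => sub_le_sub_left (hBanti 0 hsd) _
  have hsurj : γ.Surjective := fun v => by
    obtain ⟨s, hs⟩ := hBs 0 (B 0 0 - v)
    exact ⟨s, by simp [γ, hs]⟩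
  -- a monotone surjective additive function of a real variable is linear
  let Γ : ℝ →L[ℝ] ℝ := (AddMonoidHom.mk' γ hadd).toRealLinearMap
    (hmono.continuous_of_surjective hsurj)
  have hΓ : ∀ s, γ s = γ 1 * s := fun s => by
    have : Γ (s • 1) = s • Γ 1 := map_smul Γ s 1
    rw [smul_eq_mul, smul_eq_mul, mul_one, mul_comm] at this
    exact this
  refine ⟨_, _, γ 1, hL, hH, fun h0 => ?_, fun x ψ => ?_⟩
  · obtain ⟨s, hs⟩ := hsurj 1
    rw [hΓ, h0, zero_mul] at hs
    exact zero_ne_one hs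
  · have := hγ x ψ 0
    rw [add_zero, hγ0, sub_zero, hΓ] at this
    exact this.symm

/-- The adjointness relation forces `L` to be linear; by the closed graph theorem it is a
homeomorphism, and it represents every element of the bidual by a point. -/
lemma reflexive_and_equiv_of_pairing [CompleteSpace E] {L : E → StrongDual ℝ E}
    {H : StrongDual ℝ E → E} {τ : ℝ} (hL : L.Surjective) (hH : H.Surjective) (hτ : τ ≠ 0)
    (h : ∀ x ψ, L x (H ψ) = τ * ψ x) :
    ReflexiveSpace E ∧ Nonempty (E ≃L[ℝ] StrongDual ℝ E) := by
  let l : E →ₗ[ℝ] StrongDual ℝ E :=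
    { toFun := L
      map_add' := fun x y => by
        ext z
        obtain ⟨ψ, rfl⟩ := hH z
        simp [h, mul_add]
      map_smul' := fun a x => by
        ext z
        obtain ⟨ψ, rfl⟩ := hH z
        simp [h, mul_left_comm] }
  have hinj : Function.Injective l := fun x y hxy => by
    refine (SeparatingDual.eq_iff_forall_dual_eq (R := ℝ)).2 fun ψ => ?_
    have h1 : L x (H ψ) = L y (H ψ) := DFunLike.congr_fun hxy _
    rw [h, h] at h1
    exact mul_left_cancel₀ hτ h1
  have hcont : Continuous l := by
    refine l.continuous_of_seq_closed_graph fun u x φ hu hφ => ?_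
    ext z
    obtain ⟨ψ, rfl⟩ := hH z
    have h1 : Filter.Tendsto (fun n => l (u n) (H ψ)) Filter.atTop (nhds (φ (H ψ))) :=
      ((ContinuousLinearMap.apply ℝ ℝ (H ψ)).continuous.tendsto φ).comp hφ
    have h2 : Filter.Tendsto (fun n => l (u n) (H ψ)) Filter.atTop (nhds (l x (H ψ))) := by
      have h3 : ∀ y, l y (H ψ) = τ * ψ y := fun y => h y ψ
      simp only [h3]
      exact ((ψ.continuous.tendsto x).comp hu).const_mul τ
    exact tendsto_nhds_unique h1 h2
  let e : E ≃L[ℝ] StrongDual ℝ E :=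
    (LinearEquiv.ofBijective l ⟨hinj, hL⟩).toContinuousLinearEquivOfContinuous hcont
  refine ⟨fun Φ => ⟨τ⁻¹ • H (Φ.comp (e : E →L[ℝ] StrongDual ℝ E)), ?_⟩, ⟨e⟩⟩
  ext φ
  obtain ⟨x, rfl⟩ := hL φ
  have he : e x = L x := rfl
  rw [NormedSpace.dual_def, map_smul, h, smul_eq_mul, inv_mul_cancel_left₀ hτ]
  simp [he]

/-! ### Conjugation -/

/-- The Fenchel conjugate `f*`, written as the supremum of the real numbers `φ x - t` over the
points `(x, t)` of the epigraph of `f`; this equals the supremum of `φ x - f x`, and avoids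
subtraction in `EReal`. -/
noncomputable def conjFun (f : E → EReal) (φ : StrongDual ℝ E) : EReal :=
  ⨆ p : {p : E × ℝ // f p.1 ≤ (p.2 : EReal)}, ((φ p.1.1 - p.1.2 : ℝ) : EReal)

lemma conjFun_le_coe_iff {f : convCone E} {φ : StrongDual ℝ E} {r : ℝ} :
    conjFun f.1 φ ≤ r ↔ affineFun φ (-r) ≤ f := by
  rw [conjFun, iSup_le_iff, affineFun_le_iff]
  simp only [EReal.coe_le_coe_iff, Subtype.forall, Prod.forall]
  refine forall_congr' fun x => forall_congr' fun t => imp_congr_right fun _ => ?_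
  constructor <;> intro h <;> linarith

/-- The Fenchel conjugate as a map from `conv(E)` to `conv(E*)`. -/
noncomputable def conj (f : convCone E) : convCone (StrongDual ℝ E) :=
  ⟨conjFun f.1, by
    refine ⟨?_, ?_, fun φ => ?_, ?_⟩
    · intro p hp q hq a b ha hb hab
      simp only [Set.mem_ofPred_eq, conjFun_le_coe_iff, affineFun_le_iff] at hp hq ⊢
      intro x t hx
      have h1 := mul_le_mul_of_nonneg_left (hp x t hx) ha
      have h2 := mul_le_mul_of_nonneg_left (hq x t hx) hb
      have h3 : t = a * t + b * t := by rw [← add_mul, hab, one_mul]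
      simp only [Prod.fst_add, Prod.smul_fst, Prod.snd_add, Prod.smul_snd, smul_eq_mul,
        add_apply, smul_apply]
      linarith
    · refine lowerSemicontinuous_iSup fun p => Continuous.lowerSemicontinuous ?_
      exact continuous_coe_real_ereal.comp
        ((ContinuousLinearMap.apply ℝ ℝ p.1.1).continuous.sub continuous_const)
    · obtain ⟨x, t, hx⟩ := exists_eq_coe f
      exact ne_bot_of_le_ne_bot (EReal.coe_ne_bot (φ x - t))
        (le_iSup (fun p : {p : E × ℝ // f.1 p.1 ≤ (p.2 : EReal)} =>
          ((φ p.1.1 - p.1.2 : ℝ) : EReal)) ⟨(x, t), hx.le⟩)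
    · obtain ⟨ψ, e, h⟩ := exists_affineFun_le f
      refine ⟨ψ, ne_top_of_le_ne_top (EReal.coe_ne_top (-e)) (conjFun_le_coe_iff.2 ?_)⟩
      rwa [neg_neg]⟩

lemma conj_antitone : Antitone (conj (E := E)) := fun f g hfg φ => by
  refine iSup_le fun p => ?_
  exact le_iSup (fun p : {p : E × ℝ // f.1 p.1 ≤ (p.2 : EReal)} =>
    ((φ p.1.1 - p.1.2 : ℝ) : EReal)) ⟨p.1, (hfg p.1.1).trans p.2⟩

/-- The biconjugate of `f` restricts to `f` along the canonical embedding into the bidual. -/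
lemma conj_conj_apply (f : convCone E) (x : E) :
    (conj (conj f)).1 (NormedSpace.inclusionInDoubleDual ℝ E x) = f.1 x := by
  apply le_antisymm
  · refine iSup_le fun ⟨⟨φ, r⟩, hp⟩ => ?_
    exact conjFun_le_coe_iff.1 hp x
  · refine EReal.ge_of_forall_gt_iff_ge.1 fun r hr => ?_
    obtain ⟨ψ, e, h, hlt⟩ := exists_affineFun_le_of_lt f hr
    refine le_trans (EReal.coe_le_coe_iff.2 hlt.le) ?_
    refine le_iSup_of_le ⟨(ψ, -e), conjFun_le_coe_iff.2 (by rwa [neg_neg])⟩ ?_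
    simp

/-- Composition with a linear homeomorphism. -/
def compEquiv {F : Type*} [NormedAddCommGroup F] [NormedSpace ℝ F] (e : E ≃L[ℝ] F)
    (g : convCone F) : convCone E :=
  ⟨fun x => g.1 (e x), by
    refine ⟨?_, g.2.2.1.comp e.continuous, fun x => g.2.2.2.1 _, ?_⟩
    · exact g.2.1.linear_preimage (e.toLinearMap.prodMap (LinearMap.id : ℝ →ₗ[ℝ] ℝ))
    · obtain ⟨y, hy⟩ := g.2.2.2.2
      exact ⟨e.symm y, by simpa using hy⟩⟩

lemma conj_le_conj_iff {f g : convCone E} : conj f ≤ conj g ↔ g ≤ f := by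
  refine ⟨fun h x => ?_, fun h => conj_antitone h⟩
  rw [← conj_conj_apply f, ← conj_conj_apply g]
  exact conj_antitone h _

/-- On a reflexive space every element of `conv(E*)` is a conjugate. -/
lemma conj_surjective (hE : ReflexiveSpace E) : (conj (E := E)).Surjective := by
  intro h
  let i : E ≃L[ℝ] StrongDual ℝ (StrongDual ℝ E) :=
    (LinearIsometryEquiv.ofSurjective (NormedSpace.inclusionInDoubleDualLi ℝ (E := E))
      hE).toContinuousLinearEquiv
  have hi : ∀ x, i x = NormedSpace.inclusionInDoubleDual ℝ E x := fun x => rfl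
  refine ⟨compEquiv i (conj h), Subtype.ext (funext fun φ => ?_)⟩
  rw [← conj_conj_apply h φ]
  -- both sides are suprema over epigraphs that correspond to each other under `i`
  refine Function.Surjective.iSup_congr
    (fun p => ⟨(i p.1.1, p.1.2), p.2⟩) (fun ⟨⟨Φ, r⟩, hp⟩ => ?_) fun p => ?_
  · obtain ⟨x, rfl⟩ := i.surjective Φ
    exact ⟨⟨(x, r), hp⟩, rfl⟩
  · simp [hi]

lemma exists_fullyOrderReversing (hE : ReflexiveSpace E) (e : E ≃L[ℝ] StrongDual ℝ E) :
    ∃ T : convCone E → convCone E, FullyOrderReversing T := by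
  have hiff : ∀ f g : convCone E, f ≥ g ↔ compEquiv e (conj f) ≤ compEquiv e (conj g) := by
    intro f g
    rw [ge_iff_le, ← conj_le_conj_iff]
    refine ⟨fun h x => h (e x), fun h φ => ?_⟩
    obtain ⟨x, rfl⟩ := e.surjective φ
    exact h x
  refine ⟨fun f => compEquiv e (conj f), ⟨fun f g hfg => ?_, fun g => ?_⟩, hiff⟩
  · exact le_antisymm ((hiff g f).2 hfg.ge) ((hiff f g).2 hfg.le)
  · obtain ⟨f, hf⟩ := conj_surjective hE (compEquiv e.symm g)
    refine ⟨f, Subtype.ext (funext fun x => ?_)⟩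
    simp [hf, compEquiv]

end ConvCone

theorem theorem1p6 {X : Type*} [NormedAddCommGroup X] [NormedSpace ℝ X] [CompleteSpace X] :
    (∃ T : convCone X → convCone X, FullyOrderReversing T) ↔
      (ReflexiveSpace X ∧ Nonempty (X ≃L[ℝ] StrongDual ℝ X)) := by
  constructor
  · rintro ⟨T, hT⟩
    obtain ⟨L, H, τ, hL, hH, hτ, h⟩ := hT.exists_pairing
    exact reflexive_and_equiv_of_pairing hL hH hτ h
  · rintro ⟨hX, ⟨e⟩⟩
    exact exists_fullyOrderReversing hX e
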